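/- Let $E=\mathbb{R}^n$ with a fixed reference inner product $\langle\cdot,\cdot\rangle$, and let $f$ be a convex function with convex domain $D_f\subseteq\mathbb{R}^n$, twice differentiable on $D_f$, with gradient $g(x)$ and Hessian $H(x)$ (both with respect to $\langle\cdot,\cdot\rangle$), where $H(x)$ is self-adjoint and positive definite for every $x\in D_f$. For $x\in D_f$ put $\langle u,v\rangle_x=\langle u,H(x)v\rangle$, $\|u\|_x=\sqrt{\langle u,u\rangle_x}$, $B_x(x,1)=\{y:\|y-x\|_x<1\}$, and let $g_x(y)=H(x)^{-1}g(y)$ be the gradient at $y$ with respect to $\langle\cdot,\cdot\rangle_x$. Assume that $f$ is self-concordant, i.e. for all $x\in D_f$ one has $B_x(x,1)\subseteq D_f$, and for all $y\in B_x(x,1)$ and all $v\neq 0$ $$1-\|y-x\|_x\le\frac{\|v\|_y}{\|v\|_x}\le\frac{1}{1-\|y-x\|_x}.$$ Let $x_*\in D_f$ be a minimizer of $f$ on $D_f$, let $0<\delta<1$, and let $x_0\in D_f$ satisfy $\|x_0-x_*\|_{x_0}\le\tfrac12\delta$. Put $\kappa_\delta=(1-\delta)^4$. Let $0\le\varepsilon\le\frac{2(1-\delta)^4}{1+(1-\delta)^4}$,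 let $d$ satisfy $\|d-g_{x_0}(x_0)\|_{x_0}\le\varepsilon\|g_{x_0}(x_0)\|_{x_0}$, and let $x_1=x_0-\gamma d$ with $$\gamma=\frac{2(1-\delta)^4-\varepsilon\,(1+(1-\delta)^4)}{(1-\varepsilon)(1-\delta)^2\,((1-\delta)^4+1)}.$$ Then $x_1\in D_f$ and $$\|g_{x_0}(x_1)\|_{x_0}\le\Big(\frac{1-\kappa_\delta}{1+\kappa_\delta}+\varepsilon\Big)\|g_{x_0}(x_0)\|_{x_0},\qquad \|x_1-x_*\|_{x_0}\le\Big(\frac{1-\kappa_\delta}{1+\kappa_\delta}+\varepsilon\Big)\|x_0-x_*\|_{x_0}.$$ -/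

import Mathlib

open scoped Gradient

noncomputable section

namespace SelfConcordance

variable {E : Type*} [NormedAddCommGroup E] [InnerProductSpace ℝ E] [CompleteSpace E]

/-- The Hessian `H(x)` of `f` with respect to the reference inner product of `E`: the Fréchet
derivative at `x` of the gradient map `y ↦ ∇ f y`. -/
def hessian (f : E → ℝ) (x : E) : E →L[ℝ] E :=
  fderiv ℝ (fun y => ∇ f y) x

/-- The intrinsic (local) inner product `⟨u, v⟩_x = ⟨u, H(x) v⟩` of `f` at `x`. -/
def localInner (f : E → ℝ) (x u v : E) : ℝ :=
  inner ℝ u (hessian f x v)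

/-- The norm `‖u‖_x = √⟨u, u⟩_x` induced by the intrinsic inner product. -/
def localNorm (f : E → ℝ) (x u : E) : ℝ :=
  Real.sqrt (localInner f x u u)

/-- The gradient `g_x(y) = H(x)⁻¹ g(y)` of `f` at `y` with respect to the intrinsic inner product
at `x`. -/
def localGradient (f : E → ℝ) (x y : E) : E :=
  (hessian f x).inverse (∇ f y)

/-- The open ball `B_x(c, r)` of the intrinsic norm at `x`. -/
def localBall (f : E → ℝ) (x c : E) (r : ℝ) : Set E :=
  {y | localNorm f x (y - c) < r}

/-- `f` is twice differentiable on `D`, and its Hessian is self-adjoint and positive definite at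
every point of `D`, so that the intrinsic inner products `⟨·, ·⟩_x`, `x ∈ D`, are defined. -/
structure HasIntrinsicInner (D : Set E) (f : E → ℝ) : Prop where
  differentiableAt : ∀ x ∈ D, DifferentiableAt ℝ f x
  differentiableAt_gradient : ∀ x ∈ D, DifferentiableAt ℝ (fun y => ∇ f y) x
  hessian_symm : ∀ x ∈ D, ∀ u v : E, inner ℝ (hessian f x u) v = inner ℝ u (hessian f x v)
  hessian_pos : ∀ x ∈ D, ∀ v : E, v ≠ 0 → 0 < inner ℝ v (hessian f x v)

/-- Self-concordance of `f` with domain `D`. (The first condition below makes `D` open.) -/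
structure IsSelfConcordant (D : Set E) (f : E → ℝ) : Prop extends HasIntrinsicInner D f where
  ball_subset : ∀ x ∈ D, localBall f x x 1 ⊆ D
  norm_ratio : ∀ x ∈ D, ∀ y ∈ localBall f x x 1, ∀ v : E, v ≠ 0 →
    1 - localNorm f x (y - x) ≤ localNorm f y v / localNorm f x v ∧
      localNorm f y v / localNorm f x v ≤ 1 / (1 - localNorm f x (y - x))

end SelfConcordance

end

/-!
On the intrinsic ball of radius `δ` about `x₀`, self-concordance bounds the Hessian, measured with
respect to the intrinsic inner product at `x₀`, between `μ = (1 - δ)²` and `L = μ⁻¹`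
(`IsSelfConcordant.hessian_bounds`). On this ball `f` therefore behaves like a `μ`-strongly convex
function with `L`-Lipschitz gradient, where `μ / L = κ`, and one step of the inexact gradient method
is analysed in that geometry.

The mean value theorem (`IsSelfConcordant.exists_inner_gradient_sub_eq`), applied to the gradient
tested against one suitable vector, replaces a gradient difference by `M w`, with `w` the
displacement and `M = H(x₀)⁻¹ H(z)` self-adjoint for `⟨·, ·⟩_{x₀}` with spectrum in `[μ, L]`. All
that is needed of `M` is the secant inequality `⟨M w - μ w, L w - M w⟩ ≥ 0`
(`secant_inner_nonneg`). Both contraction estimates are then inequalities between vectors of an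
inner product space (`norm_sub_smul_add_le` for the distance to the minimizer and
`norm_sub_smul_le` for the gradient). In both the worst case is the smallest curvature `μ`,
with the error shortening the gradient to `(1 - ε) g`. The step length satisfies
`γ μ (1 - ε) = 2 μ / (L + μ) - ε`, so the rate is
`1 - γ μ (1 - ε) = (1 - κ) / (1 + κ) + ε ≤ 1`.

The distance estimate only involves the segment from `x₀` to the minimizer. As the rate is at most
`1`, it shows that the new point is within `δ / 2 + δ / 2 = δ` of `x₀`, hence in the domain, and
that the segment from `x₀` to the new point stays in the ball, as the gradient estimate requires.
The intrinsic norm is turned into an ordinary Euclidean norm by `exists_linearMap_inner_eq`.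
-/

namespace SelfConcordance

/-! ### Contraction inequalities in an inner product space -/

section VectorInequalities

variable {F : Type*} [NormedAddCommGroup F] [InnerProductSpace ℝ F]

/-- One inexact gradient step contracts the distance, when the gradient difference `p` and the
displacement `r` satisfy the secant inequality with constants `μ` and `L`. The hypothesis `hγ` is
exactly the condition under which the worst case `‖r - γ p‖ + γ ε ‖p‖` is stationary at `p = μ r`;
the bound follows from two tangent estimates `2ab ≤ a² + b²` that are tight there. -/
theorem norm_sub_smul_add_le {μ L γ ε : ℝ} {r p : F} (hμ : 0 < μ) (hL : 0 < L)
    (hγ0 : 0 ≤ γ) (hε0 : 0 ≤ ε) (hγμ : γ * μ < 1)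
    (hγ : (L + μ) * (γ * μ * (1 - ε) + ε) = 2 * μ)
    (hp : 0 ≤ inner ℝ (p - μ • r) (L • r - p)) :
    ‖r - γ • p‖ + γ * ε * ‖p‖ ≤ (1 - γ * μ * (1 - ε)) * ‖r‖ := by
  have hsec : ‖p‖ ^ 2 + L * μ * ‖r‖ ^ 2 ≤ (L + μ) * inner ℝ p r := by
    have : inner ℝ (p - μ • r) (L • r - p)
        = (L + μ) * inner ℝ p r - ‖p‖ ^ 2 - L * μ * ‖r‖ ^ 2 := by
      simp only [inner_sub_left, inner_sub_right, inner_smul_left, inner_smul_right,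
        real_inner_self_eq_norm_sq, real_inner_comm p r, conj_trivial]
      ring
    linarith
  have hX : ‖r - γ • p‖ ^ 2 = ‖r‖ ^ 2 - 2 * γ * inner ℝ p r + γ ^ 2 * ‖p‖ ^ 2 := by
    rw [norm_sub_sq_real, inner_smul_right, norm_smul, Real.norm_of_nonneg hγ0,
      real_inner_comm r p]
    ring
  rcases (norm_nonneg r).eq_or_lt with hr | hr
  · have hr0 : r = 0 := norm_eq_zero.mp hr.symm
    subst hr0
    have hp0 : p = 0 := by
      have : ‖p‖ ^ 2 ≤ 0 := by simpa using hsec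
      exact norm_eq_zero.mp (by nlinarith [norm_nonneg p])
    simp [hp0]
  set R := ‖r‖
  set s := ‖p‖
  set X := ‖r - γ • p‖
  set q : ℝ := inner ℝ p r
  have hb : 0 < 1 - γ * μ := by linarith
  have hLμ : 0 < L + μ := by linarith
  have h1 : 2 * (1 - γ * μ) * R * X ≤ X ^ 2 + (1 - γ * μ) ^ 2 * R ^ 2 := by
    nlinarith [sq_nonneg (X - (1 - γ * μ) * R)]
  have h2 : 2 * μ * R * s ≤ s ^ 2 + μ ^ 2 * R ^ 2 := by nlinarith [sq_nonneg (s - μ * R)]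
  have key : (L + μ) * (2 * (1 - γ * μ) * μ * R) * (X + γ * ε * s) ≤
      (L + μ) * (2 * (1 - γ * μ) * μ * R) * ((1 - γ * μ * (1 - ε)) * R) := by
    have h1' := mul_le_mul_of_nonneg_left h1 (mul_pos hLμ hμ).le
    have h2' := mul_le_mul_of_nonneg_left h2
      (show 0 ≤ (L + μ) * ((1 - γ * μ) * (γ * ε)) by positivity)
    have h3' := mul_le_mul_of_nonneg_left hsec (show 0 ≤ 2 * γ * μ by positivity)
    rw [hX] at h1'
    linear_combination h1' + h2' + h3' + (γ * s ^ 2 - γ * μ ^ 2 * R ^ 2) * hγ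
  exact le_of_mul_le_mul_left key (by positivity)

/-- One inexact gradient step contracts the gradient: `g` is the old gradient, `w` the inexact
direction and `γ p` the decrease of the gradient along the step. The secant inequality confines `p`
to a ball around `((L + μ) / 2) w`, and the resulting bound is largest at `w = (1 - ε) g`, `p = μ w`,
where the tangent estimates `2ab ≤ a² + b²` used below are tight. -/
theorem norm_sub_smul_le {μ L γ ε : ℝ} {g w p : F} (hμ : 0 < μ) (hL : μ ≤ L)
    (hγ0 : 0 ≤ γ) (hε0 : 0 ≤ ε) (hε1 : ε < 1)
    (hγ : (L + μ) * (γ * μ * (1 - ε) + ε) = 2 * μ)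
    (hw : ‖w - g‖ ≤ ε * ‖g‖)
    (hp : 0 ≤ inner ℝ (p - μ • w) (L • w - p)) :
    ‖g - γ • p‖ ≤ (1 - γ * μ * (1 - ε)) * ‖g‖ := by
  obtain ⟨c, hc⟩ : ∃ c, c = (L + μ) / 2 := ⟨_, rfl⟩
  have hcμ : μ ≤ c := by linarith
  have hc0 : 0 < c := by linarith
  have hLc : L = 2 * c - μ := by linarith
  subst hLc
  -- The secant condition places `p` in the ball with centre `c • w` and radius `(c - μ) * ‖w‖`.
  have hball : ‖c • w - p‖ ≤ (c - μ) * ‖w‖ := by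
    refine le_of_sq_le_sq ?_ (mul_nonneg (by linarith) (norm_nonneg _))
    have : inner ℝ (p - μ • w) ((2 * c - μ) • w - p)
        = ((c - μ) * ‖w‖) ^ 2 - ‖c • w - p‖ ^ 2 := by
      rw [norm_sub_sq_real]
      simp only [inner_sub_left, inner_sub_right, inner_smul_left, inner_smul_right,
        real_inner_self_eq_norm_sq, real_inner_comm p w, conj_trivial, norm_smul,
        Real.norm_eq_abs, mul_pow, sq_abs]
      ring
    linarith
  obtain ⟨e, he⟩ : ∃ e, e = w - g := ⟨_, rfl⟩
  have hwe : w = g + e := by rw [he]; abel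
  rw [← he] at hw
  have htri : ‖g - γ • p‖ ≤ ‖g - (γ * c) • w‖ + γ * ((c - μ) * ‖w‖) := by
    calc ‖g - γ • p‖ = ‖(g - (γ * c) • w) + γ • (c • w - p)‖ := by
          congr 1; rw [smul_sub, smul_smul]; abel
      _ ≤ _ := by
          refine (norm_add_le _ _).trans ?_
          rw [norm_smul, Real.norm_of_nonneg hγ0]
          gcongr
  refine htri.trans ?_
  have hY : ‖g - (γ * c) • w‖ ^ 2 = (1 - γ * c) ^ 2 * ‖g‖ ^ 2
      - 2 * (γ * c) * (1 - γ * c) * inner ℝ g e + (γ * c) ^ 2 * ‖e‖ ^ 2 := by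
    have : g - (γ * c) • w = (1 - γ * c) • g - (γ * c) • e := by
      rw [hwe]; module
    rw [this, norm_sub_sq_real, norm_smul, norm_smul, inner_smul_left, inner_smul_right,
      mul_pow, mul_pow, Real.norm_eq_abs, Real.norm_eq_abs, sq_abs, sq_abs, conj_trivial]
    ring
  have hW : ‖w‖ ^ 2 = ‖g‖ ^ 2 + 2 * inner ℝ g e + ‖e‖ ^ 2 := by
    rw [hwe, norm_add_sq_real]
  -- For `ε = 0` the worst value of `‖g - (γ * c) • w‖` is `0`, so no tangent estimate is available.
  rcases hε0.eq_or_lt with rfl | hεpos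
  · have he0 : e = 0 := by simpa using hw
    have hγc : γ * c = 1 := by
      have : μ * (γ * c - 1) = 0 := by linear_combination hγ / 2
      have := (mul_eq_zero.mp this).resolve_left hμ.ne'
      linarith
    rw [hwe, he0, add_zero, hγc]
    simp only [one_smul, sub_self, norm_zero]
    linear_combination ‖g‖ * hγc
  rcases (norm_nonneg g).eq_or_lt with hg | hg
  · have hg0 : g = 0 := norm_eq_zero.mp hg.symm
    have he0 : e = 0 := by simpa [hg0] using hw
    simp [hwe, he0, hg0]
  have he2 : ‖e‖ ^ 2 ≤ ε ^ 2 * ‖g‖ ^ 2 := by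
    rw [← mul_pow]; gcongr
  set G := ‖g‖
  set Y := ‖g - (γ * c) • w‖
  set W := ‖w‖
  set q : ℝ := inner ℝ g e
  set S := ‖e‖ ^ 2
  have hb : 0 < 1 - ε := by linarith
  -- At the worst case, `‖g - (γ * c) • w‖ = a * ‖g‖` and `‖w‖ = (1 - ε) * ‖g‖`.
  obtain ⟨a, ha⟩ : ∃ a, a = 1 - γ * c * (1 - ε) := ⟨_, rfl⟩
  have haμ : μ * a = c * ε := by rw [ha]; linear_combination -hγ / 2
  have ha0 : 0 < a := by
    have : 0 < μ * a := by rw [haμ]; positivity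
    exact pos_of_mul_pos_right this hμ.le
  have h1 : 2 * a * G * Y ≤ Y ^ 2 + a ^ 2 * G ^ 2 := by nlinarith [sq_nonneg (Y - a * G)]
  have h2 : 2 * (1 - ε) * G * W ≤ W ^ 2 + (1 - ε) ^ 2 * G ^ 2 := by
    nlinarith [sq_nonneg (W - (1 - ε) * G)]
  have hγcε : (1 - ε) * (1 - γ * c) = a - ε := by rw [ha]; ring
  -- The choice of `γ` makes the coefficients of `⟨g, e⟩` in the two tangent estimates cancel.
  have hbal : (1 - ε) * (c * (1 - γ * c)) = a * (c - μ) := by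
    linear_combination c * hγcε + haμ
  have h1' := mul_le_mul_of_nonneg_left h1 hb.le
  have h2' := mul_le_mul_of_nonneg_left h2
    (show 0 ≤ a * (γ * (c - μ)) from mul_nonneg ha0.le (mul_nonneg hγ0 (by linarith)))
  have h3' := mul_le_mul_of_nonneg_left he2
    (show 0 ≤ (1 - ε) * (γ * c) ^ 2 + a * (γ * (c - μ)) from
      add_nonneg (by positivity) (mul_nonneg ha0.le (mul_nonneg hγ0 (by linarith))))
  rw [hY] at h1'
  rw [hW] at h2'
  have key : (2 * a * (1 - ε) * G) * (Y + γ * ((c - μ) * W)) ≤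
      (2 * a * (1 - ε) * G) * ((1 - γ * μ * (1 - ε)) * G) := by
    have e1 : (1 - ε) * ((1 - γ * c) ^ 2 + ε ^ 2 * (γ * c) ^ 2 + a ^ 2) +
        a * (γ * (c - μ)) * (1 + ε ^ 2 + (1 - ε) ^ 2) =
        2 * a * (1 - ε) * (1 - γ * μ * (1 - ε)) := by
      have hγa : 1 - γ * μ * (1 - ε) = a + γ * (c - μ) * (1 - ε) := by rw [ha]; ring
      have h5 : a * (γ * (c - μ)) = (1 - ε) * (γ * c * (1 - γ * c)) := by
        linear_combination -γ * hbal
      rw [hγa]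
      linear_combination (1 + ε ^ 2 - (1 - ε) ^ 2) * h5
        - (1 - ε) * (a + (1 - γ * c * (1 - ε))) * ha
    linear_combination h1' + h2' + h3' + G ^ 2 * e1 - 2 * γ * q * hbal
  exact le_of_mul_le_mul_left key (by positivity)

end VectorInequalities

/-! ### Forms of positive semidefinite operators -/

section PosSemidef

variable {E : Type*} [NormedAddCommGroup E] [InnerProductSpace ℝ E]

/-- The Cauchy–Schwarz inequality for the form `⟨u, P v⟩` of a positive semidefinite operator. -/
theorem sq_inner_apply_le_of_nonneg {P : E →L[ℝ] E}
    (hsymm : ∀ u v, inner ℝ (P u) v = inner ℝ u (P v)) (hpos : ∀ v, 0 ≤ inner ℝ v (P v))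
    (u v : E) : inner ℝ u (P v) ^ 2 ≤ inner ℝ u (P u) * inner ℝ v (P v) := by
  have h : ∀ t : ℝ, 0 ≤ inner ℝ v (P v) * (t * t) + 2 * inner ℝ u (P v) * t
      + inner ℝ u (P u) := by
    intro t
    have := hpos (u + t • v)
    have hvu : inner ℝ v (P u) = inner ℝ u (P v) := by
      rw [← hsymm, real_inner_comm]
    simp only [map_add, map_smul, inner_add_left, inner_add_right, inner_smul_left,
      inner_smul_right, conj_trivial, hvu] at this
    linarith
  have := discrim_le_zero h
  rw [discrim] at this
  linarith

/-- The form `⟨u, A v⟩` of a positive semidefinite operator is the pullback of a Euclidean inner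
product: in an orthonormal eigenbasis of `A`, `T` is the diagonal map with entries the square roots
of the eigenvalues. -/
theorem exists_linearMap_inner_eq [FiniteDimensional ℝ E] {A : E →L[ℝ] E}
    (hsymm : ∀ u v, inner ℝ (A u) v = inner ℝ u (A v)) (hpos : ∀ v, 0 ≤ inner ℝ v (A v)) :
    ∃ T : E →ₗ[ℝ] EuclideanSpace ℝ (Fin (Module.finrank ℝ E)),
      ∀ u v, inner ℝ (T u) (T v) = inner ℝ u (A v) := by
  have hA : (A : E →ₗ[ℝ] E).IsSymmetric := hsymm
  let b := hA.eigenvectorBasis rfl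
  let l := hA.eigenvalues rfl
  have hAb : ∀ i, A (b i) = l i • b i := fun i => hA.apply_eigenvectorBasis rfl i
  have hl : ∀ i, 0 ≤ l i := fun i => by
    have := hpos (b i)
    rwa [hAb, inner_smul_right, real_inner_self_eq_norm_sq, b.orthonormal.1 i, one_pow,
      mul_one] at this
  refine ⟨(WithLp.linearEquiv 2 ℝ (Fin (Module.finrank ℝ E) → ℝ)).symm.toLinearMap ∘ₗ
    LinearMap.pi fun i => Real.sqrt (l i) • (innerSL ℝ (b i)).toLinearMap, fun u v => ?_⟩
  rw [← b.sum_inner_mul_inner u (A v)]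
  simp only [PiLp.inner_apply]
  refine Finset.sum_congr rfl fun i _ => ?_
  rw [← hsymm, hAb, inner_smul_left, real_inner_comm (b i) u]
  change (Real.sqrt (l i) * inner ℝ (b i) v) * (Real.sqrt (l i) * inner ℝ (b i) u)
    = inner ℝ (b i) u * (l i * inner ℝ (b i) v)
  linear_combination (inner ℝ (b i) u * inner ℝ (b i) v) * Real.mul_self_sqrt (hl i)

/-- If `μ A ≤ B ≤ L A` as quadratic forms and `M = A⁻¹ B`, then `(M - μ)(L - M)` is positive
semidefinite for the form of `A`; here `p = M w`, that is, `A p = B w`. This is the Cauchy–Schwarz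
inequality for the form of `B - μ A`. -/
theorem secant_inner_nonneg {A B : E →L[ℝ] E} {μ L : ℝ}
    (hA : ∀ u v, inner ℝ (A u) v = inner ℝ u (A v))
    (hApos : ∀ v, 0 ≤ inner ℝ v (A v))
    (hB : ∀ u v, inner ℝ (B u) v = inner ℝ u (B v))
    (hlow : ∀ v, μ * inner ℝ v (A v) ≤ inner ℝ v (B v))
    (hup : ∀ v, inner ℝ v (B v) ≤ L * inner ℝ v (A v))
    {w p : E} (hp : A p = B w) :
    0 ≤ inner ℝ (p - μ • w) (A (L • w - p)) := by
  obtain ⟨q, hq⟩ : ∃ q, q = p - μ • w := ⟨_, rfl⟩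
  have hAq : A q = (B - μ • A) w := by simp [hq, hp]
  have hcs := sq_inner_apply_le_of_nonneg (P := B - μ • A)
    (fun u v => by simp [inner_sub_left, inner_sub_right, inner_smul_left, inner_smul_right,
      hA, hB])
    (fun v => by
      have := hlow v
      simp only [sub_apply, smul_apply, inner_sub_right,
        inner_smul_right]
      linarith) q w
  rw [← hAq] at hcs
  have hqq : inner ℝ q ((B - μ • A) q) ≤ (L - μ) * inner ℝ q (A q) := by
    have := hup q
    simp only [sub_apply, smul_apply, inner_sub_right,
        inner_smul_right]
    linarith
  have hwq : inner ℝ w (A q) = inner ℝ q (A w) := by rw [← hA, real_inner_comm]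
  have hgoal : inner ℝ (p - μ • w) (A (L • w - p))
      = (L - μ) * inner ℝ w (A q) - inner ℝ q (A q) := by
    rw [hwq, ← hq, show L • w - p = (L - μ) • w - q by rw [hq]; module]
    simp [inner_sub_right, inner_smul_right]
  have hw0 : 0 ≤ inner ℝ w (A q) := by
    have := hlow w
    rw [hAq]
    simp only [sub_apply, smul_apply, inner_sub_right,
        inner_smul_right]
    linarith
  rw [hgoal]
  rcases (hApos q).eq_or_lt with h0 | h0
  · have hzero : inner ℝ w (A q) = 0 := by
      have := sq_inner_apply_le_of_nonneg hA hApos w q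
      rw [← h0, mul_zero] at this
      nlinarith
    rw [← h0, hzero]; simp
  · have : inner ℝ q (A q) * inner ℝ q (A q) ≤ inner ℝ q (A q) * ((L - μ) * inner ℝ w (A q)) := by
      nlinarith [mul_le_mul_of_nonneg_right hqq hw0]
    linarith [le_of_mul_le_mul_left this h0]

end PosSemidef

/-! ### Hessians and gradients of self-concordant functions -/

variable {E : Type*} [NormedAddCommGroup E] [InnerProductSpace ℝ E] [CompleteSpace E]
  {D : Set E} {f : E → ℝ} {x y : E}

theorem localNorm_smul (f : E → ℝ) (x : E) (t : ℝ) (v : E) :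
    localNorm f x (t • v) = |t| * localNorm f x v := by
  rw [localNorm, localNorm, localInner, localInner, map_smul, inner_smul_left, inner_smul_right,
    conj_trivial, ← mul_assoc, Real.sqrt_mul (mul_self_nonneg t), Real.sqrt_mul_self_eq_abs]

theorem IsSelfConcordant.mem_nhds (h : IsSelfConcordant D f) (hx : x ∈ D) : D ∈ nhds x := by
  refine Filter.mem_of_superset (IsOpen.mem_nhds ?_ ?_) (h.ball_subset x hx)
  · refine isOpen_lt ?_ continuous_const
    unfold localNorm localInner
    fun_prop
  · simp [localBall, localNorm, localInner]

theorem IsSelfConcordant.gradient_eq_zero (h : IsSelfConcordant D f) (hx : x ∈ D)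
    (hmin : IsMinOn f D x) : ∇ f x = 0 := by
  simp [gradient, (hmin.isLocalMin (h.mem_nhds hx)).fderiv_eq_zero]

theorem HasIntrinsicInner.inner_hessian_nonneg (h : HasIntrinsicInner D f) (hx : x ∈ D) (v : E) :
    0 ≤ inner ℝ v (hessian f x v) := by
  rcases eq_or_ne v 0 with rfl | hv
  · simp
  · exact (h.hessian_pos x hx v hv).le

theorem HasIntrinsicInner.isInvertible_hessian [FiniteDimensional ℝ E]
    (h : HasIntrinsicInner D f) (hx : x ∈ D) : (hessian f x).IsInvertible := by
  have hinj : Function.Injective (hessian f x : E →ₗ[ℝ] E) := by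
    rw [← LinearMap.ker_eq_bot, LinearMap.ker_eq_bot']
    intro v hv
    by_contra hne
    have := h.hessian_pos x hx v hne
    simp only [ContinuousLinearMap.coe_coe] at hv
    simp [hv] at this
  exact ⟨(LinearEquiv.ofInjectiveEndo _ hinj).toContinuousLinearEquiv, by ext; rfl⟩

/-- On the intrinsic ball of radius `δ < 1` about `x`, the quadratic form of the Hessian is between
`(1 - δ)²` and `(1 - δ)⁻²` times that at `x`. -/
theorem IsSelfConcordant.hessian_bounds (h : IsSelfConcordant D f) (hx : x ∈ D) {δ : ℝ}
    (hδ : δ < 1) (hy : localNorm f x (y - x) ≤ δ) (v : E) :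
    (1 - δ) ^ 2 * inner ℝ v (hessian f x v) ≤ inner ℝ v (hessian f y v) ∧
      inner ℝ v (hessian f y v) ≤ ((1 - δ) ^ 2)⁻¹ * inner ℝ v (hessian f x v) := by
  rcases eq_or_ne v 0 with rfl | hv
  · simp
  have hyb : y ∈ localBall f x x 1 := hy.trans_lt hδ
  have hyD := h.ball_subset x hx hyb
  have hxv : 0 < localNorm f x v := Real.sqrt_pos.mpr (h.hessian_pos x hx v hv)
  have hx2 : localNorm f x v ^ 2 = inner ℝ v (hessian f x v) :=
    Real.sq_sqrt (h.inner_hessian_nonneg hx v)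
  have hy2 : localNorm f y v ^ 2 = inner ℝ v (hessian f y v) :=
    Real.sq_sqrt (h.inner_hessian_nonneg hyD v)
  obtain ⟨h1, h2⟩ := h.norm_ratio x hx y hyb v hv
  rw [le_div_iff₀ hxv] at h1
  rw [div_le_iff₀ hxv] at h2
  have hδ' : 0 < 1 - δ := by linarith
  have h1' : (1 - δ) * localNorm f x v ≤ localNorm f y v :=
    (mul_le_mul_of_nonneg_right (by linarith) hxv.le).trans h1
  have h2' : localNorm f y v ≤ (1 - δ)⁻¹ * localNorm f x v := by
    refine h2.trans (mul_le_mul_of_nonneg_right ?_ hxv.le)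
    rw [one_div]
    exact inv_anti₀ hδ' (by linarith)
  rw [← hx2, ← hy2, ← inv_pow, ← mul_pow, ← mul_pow]
  exact ⟨by gcongr, by gcongr; exact Real.sqrt_nonneg _⟩

/-- A mean value theorem for the gradient tested against one vector `u`. Differentiability of the
gradient suffices, with no integration of the Hessian; the point `z` depends on `u`. -/
theorem IsSelfConcordant.exists_inner_gradient_sub_eq (h : IsSelfConcordant D f) (hx : x ∈ D)
    {δ : ℝ} (hδ : δ < 1) (hy : localNorm f x (y - x) ≤ δ) (u : E) :
    ∃ z ∈ D, localNorm f x (z - x) ≤ δ ∧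
      inner ℝ u (∇ f y - ∇ f x) = inner ℝ u (hessian f z (y - x)) := by
  have hn : ∀ t ∈ Set.Icc (0 : ℝ) 1, localNorm f x ((x + t • (y - x)) - x) ≤ δ := by
    intro t ht
    rw [add_sub_cancel_left, localNorm_smul, abs_of_nonneg ht.1]
    exact (mul_le_of_le_one_left (Real.sqrt_nonneg _) ht.2).trans hy
  have hD : ∀ t ∈ Set.Icc (0 : ℝ) 1, x + t • (y - x) ∈ D := fun t ht =>
    h.ball_subset x hx ((hn t ht).trans_lt hδ)
  have hderiv : ∀ t ∈ Set.Icc (0 : ℝ) 1,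
      HasDerivAt (fun t : ℝ => inner ℝ u (∇ f (x + t • (y - x))))
        (inner ℝ u (hessian f (x + t • (y - x)) (y - x))) t := by
    intro t ht
    have hline : HasDerivAt (fun t : ℝ => x + t • (y - x)) (y - x) t := by
      simpa using ((hasDerivAt_id t).smul_const (y - x)).const_add x
    have hg := (h.differentiableAt_gradient _ (hD t ht)).hasFDerivAt.comp_hasDerivAt t hline
    exact (innerSL ℝ u).hasFDerivAt.comp_hasDerivAt t hg
  obtain ⟨t, ht, heq⟩ := exists_hasDerivAt_eq_slope
    (fun t : ℝ => inner ℝ u (∇ f (x + t • (y - x)))) _ zero_lt_one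
    (fun t ht => (hderiv t ht).continuousAt.continuousWithinAt)
    (fun t ht => hderiv t (Set.Ioo_subset_Icc_self ht))
  have ht' := Set.Ioo_subset_Icc_self ht
  refine ⟨_, hD t ht', hn t ht', ?_⟩
  rw [heq]
  simp [inner_sub_right]

end SelfConcordance

open SelfConcordance in
theorem mainTheorem6 {E : Type*} [NormedAddCommGroup E] [InnerProductSpace ℝ E]
    [FiniteDimensional ℝ E] [CompleteSpace E]
    (D : Set E) (f : E → ℝ) (hconv : ConvexOn ℝ D f)
    (hsc : SelfConcordance.IsSelfConcordant D f)
    (xstar : E) (hxstar : xstar ∈ D) (hmin : IsMinOn f D xstar)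
    (δ : ℝ) (hδ0 : 0 < δ) (hδ1 : δ < 1)
    (x₀ : E) (hx₀ : x₀ ∈ D)
    (hclose : SelfConcordance.localNorm f x₀ (x₀ - xstar) ≤ δ / 2)
    (ε : ℝ) (hε0 : 0 ≤ ε) (hε : ε ≤ 2 * (1 - δ) ^ 4 / (1 + (1 - δ) ^ 4))
    (d : E)
    (hd : SelfConcordance.localNorm f x₀ (d - SelfConcordance.localGradient f x₀ x₀) ≤
      ε * SelfConcordance.localNorm f x₀ (SelfConcordance.localGradient f x₀ x₀))
    (γ : ℝ)
    (hγ : γ = (2 * (1 - δ) ^ 4 - ε * (1 + (1 - δ) ^ 4)) /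
      ((1 - ε) * (1 - δ) ^ 2 * ((1 - δ) ^ 4 + 1)))
    (x₁ : E) (hx₁ : x₁ = x₀ - γ • d)
    (κ : ℝ) (hκ : κ = (1 - δ) ^ 4) :
    x₁ ∈ D ∧
    SelfConcordance.localNorm f x₀ (SelfConcordance.localGradient f x₀ x₁) ≤
      ((1 - κ) / (1 + κ) + ε) *
        SelfConcordance.localNorm f x₀ (SelfConcordance.localGradient f x₀ x₀) ∧
    SelfConcordance.localNorm f x₀ (x₁ - xstar) ≤
      ((1 - κ) / (1 + κ) + ε) * SelfConcordance.localNorm f x₀ (x₀ - xstar) := by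
  obtain ⟨T, hT⟩ := exists_linearMap_inner_eq (hsc.hessian_symm x₀ hx₀)
    (hsc.inner_hessian_nonneg hx₀)
  have hTnorm : ∀ u, localNorm f x₀ u = ‖T u‖ := fun u => by
    rw [localNorm, localInner, ← hT, real_inner_self_eq_norm_sq, Real.sqrt_sq (norm_nonneg _)]
  have hinv := hsc.isInvertible_hessian hx₀
  have hHinv : ∀ v, hessian f x₀ ((hessian f x₀).inverse v) = v := hinv.self_apply_inverse
  have hTG : ∀ u y, inner ℝ (T u) (T (localGradient f x₀ y)) = inner ℝ u (∇ f y) := fun u y => by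
    rw [hT, localGradient, hHinv]
  obtain ⟨μ, hμ⟩ : ∃ μ, μ = (1 - δ) ^ 2 := ⟨_, rfl⟩
  have hμ0 : 0 < μ := by rw [hμ]; exact pow_pos (by linarith) 2
  have hμ1 : μ < 1 := by rw [hμ]; nlinarith
  have hμ4 : (1 - δ) ^ 4 = μ ^ 2 := by rw [hμ]; ring
  rw [hμ4] at hε hγ hκ
  rw [← hμ] at hγ
  subst hκ
  have hμsq : μ ^ 2 < 1 := by nlinarith
  have hε' : ε * (1 + μ ^ 2) ≤ 2 * μ ^ 2 := by rwa [le_div_iff₀ (by positivity)] at hε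
  have hε1 : ε < 1 := hε.trans_lt (by rw [div_lt_one (by positivity)]; linarith)
  have hε1' : 0 < 1 - ε := by linarith
  have hγ0 : 0 ≤ γ := by
    rw [hγ]; exact div_nonneg (by linarith) (by positivity)
  have hγeq : γ * μ * (1 - ε) * (1 + μ ^ 2) = 2 * μ ^ 2 - ε * (1 + μ ^ 2) := by
    rw [hγ]; field_simp
    ring
  have hstep : (μ⁻¹ + μ) * (γ * μ * (1 - ε) + ε) = 2 * μ := by
    field_simp
    linear_combination hγeq
  have hrate : (1 - μ ^ 2) / (1 + μ ^ 2) + ε = 1 - γ * μ * (1 - ε) := by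
    field_simp
    linear_combination hγeq
  have hγμ : γ * μ < 1 := by
    have : (1 - γ * μ) * ((1 - ε) * (1 + μ ^ 2)) = 1 - μ ^ 2 := by linear_combination -hγeq
    have := pos_of_mul_pos_left (this ▸ (by linarith : 0 < 1 - μ ^ 2)) (by positivity)
    linarith
  have hrate1 : 1 - γ * μ * (1 - ε) ≤ 1 := by
    have : 0 ≤ γ * μ * (1 - ε) := by positivity
    linarith
  -- Tested against `u`, the change of the gradient along `s • w` is `s • p` with `p = M w`, where
  -- `M` is the Hessian at an intermediate point relative to that at `x₀`.
  have hsecant : ∀ y, localNorm f x₀ (y - x₀) ≤ δ → ∀ u (s : ℝ) w, y - x₀ = s • w → ∃ p,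
      inner ℝ (T u) (T (localGradient f x₀ y) - T (localGradient f x₀ x₀)) =
        s * inner ℝ (T u) (T p) ∧
      0 ≤ inner ℝ (T p - μ • T w) (μ⁻¹ • T w - T p) := by
    intro y hy u s w hw
    obtain ⟨z, hzD, hz, heq⟩ := hsc.exists_inner_gradient_sub_eq hx₀ hδ1 hy u
    have hb := hsc.hessian_bounds hx₀ hδ1 hz
    rw [← hμ] at hb
    refine ⟨(hessian f x₀).inverse (hessian f z w), ?_, ?_⟩
    · rw [inner_sub_right, hTG, hTG, ← inner_sub_right, heq, hw, hT, hHinv, map_smul,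
        inner_smul_right]
    · rw [← map_smul, ← map_smul, ← map_sub, ← map_sub, hT]
      exact secant_inner_nonneg (hsc.hessian_symm x₀ hx₀) (hsc.inner_hessian_nonneg hx₀)
        (hsc.hessian_symm z hzD) (fun v => (hb v).1) (fun v => (hb v).2) (hHinv _)
  have hstar : localGradient f x₀ xstar = 0 := by
    rw [localGradient, hsc.gradient_eq_zero hxstar hmin, map_zero]
  simp only [hTnorm] at hclose hd hsecant ⊢
  rw [hrate]
  obtain ⟨g, hg⟩ : ∃ g, g = T (localGradient f x₀ x₀) := ⟨_, rfl⟩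
  rw [map_sub, ← hg] at hd
  rw [← hg] at hsecant ⊢
  have hdist : ‖T (x₁ - xstar)‖ ≤ (1 - γ * μ * (1 - ε)) * ‖T (x₀ - xstar)‖ := by
    obtain ⟨U, hU⟩ : ∃ U, U = T (x₁ - xstar) := ⟨_, rfl⟩
    have hUeq : U = T (x₀ - xstar) - γ • g - γ • (T d - g) := by
      rw [hU, hx₁, show x₀ - γ • d - xstar = (x₀ - xstar) - γ • d by abel, map_sub, map_smul]
      module
    -- The mean value point depends on the test vector, so one vector has to test both the
    -- displacement `U` and, through `g / ‖g‖`, the term `γ * ε * ‖g‖` from the inexact direction.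
    obtain ⟨p, hp, hps⟩ := hsecant xstar
      (by rw [← neg_sub, map_neg, norm_neg]; linarith)
      (-γ • (x₁ - xstar) + (γ * ε * ‖U‖ * ‖g‖⁻¹) • localGradient f x₀ x₀) (-1) (x₀ - xstar)
      (by simp)
    rw [hstar, map_zero, zero_sub, inner_neg_right, neg_one_mul, neg_inj, map_add, map_smul,
      map_smul, ← hg, ← hU, inner_add_left, inner_add_left, inner_smul_left, inner_smul_left,
      inner_smul_left, inner_smul_left, real_inner_self_eq_norm_sq] at hp
    simp only [conj_trivial] at hp
    have hgg : ‖g‖⁻¹ * ‖g‖ ^ 2 = ‖g‖ := by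
      rcases eq_or_ne ‖g‖ 0 with h0 | h0
      · simp [h0]
      · field_simp
    have hgp : ‖g‖⁻¹ * inner ℝ g (T p) ≤ ‖T p‖ := by
      rcases (norm_nonneg g).eq_or_lt with h0 | h0
      · simp [← h0]
      · rw [inv_mul_le_iff₀ h0]; exact real_inner_le_norm _ _
    have hvec := norm_sub_smul_add_le hμ0 (inv_pos.mpr hμ0) hγ0 hε0 hγμ hstep hps
    have herr : -inner ℝ U (T d - g) ≤ ‖U‖ * (ε * ‖g‖) := by
      rw [← inner_neg_right]
      refine (real_inner_le_norm _ _).trans ?_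
      rw [norm_neg]
      gcongr
    have hUU : ‖U‖ ^ 2 = inner ℝ U (T (x₀ - xstar)) - γ * inner ℝ U g
        - γ * inner ℝ U (T d - g) := by
      rw [← real_inner_self_eq_norm_sq]
      nth_rewrite 2 [hUeq]
      rw [inner_sub_right, inner_sub_right, inner_smul_right, inner_smul_right]
    have hmain := real_inner_le_norm U (T (x₀ - xstar) - γ • T p)
    rw [inner_sub_right, inner_smul_right] at hmain
    have e1 := mul_le_mul_of_nonneg_left herr hγ0
    have e2 := mul_le_mul_of_nonneg_left hgp (show 0 ≤ γ * ε * ‖U‖ by positivity)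
    have e3 := mul_le_mul_of_nonneg_left hvec (norm_nonneg U)
    rw [← hU]
    have hfin : ‖U‖ * ‖U‖ ≤ ‖U‖ * ((1 - γ * μ * (1 - ε)) * ‖T (x₀ - xstar)‖) := by
      linear_combination hUU + e1 + hmain + e2 + e3 + hp - γ * ε * ‖U‖ * hgg
    rcases (norm_nonneg U).eq_or_lt with h0 | h0
    · rw [← h0, hrate.symm]
      have : 0 ≤ (1 - μ ^ 2) / (1 + μ ^ 2) := div_nonneg (by linarith) (by positivity)
      positivity
    · exact le_of_mul_le_mul_left hfin h0
  have hx₁x₀ : ‖T (x₁ - x₀)‖ ≤ δ := by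
    rw [show x₁ - x₀ = (x₁ - xstar) - (x₀ - xstar) by abel, map_sub]
    refine (norm_sub_le _ _).trans ?_
    have := mul_le_mul_of_nonneg_right hrate1 (norm_nonneg (T (x₀ - xstar)))
    linarith
  refine ⟨hsc.ball_subset x₀ hx₀ ?_, ?_, hdist⟩
  · change localNorm f x₀ (x₁ - x₀) < 1
    rw [hTnorm]
    linarith
  obtain ⟨V, hV⟩ : ∃ V, V = T (localGradient f x₀ x₁) := ⟨_, rfl⟩
  obtain ⟨p, hp, hps⟩ := hsecant x₁ hx₁x₀ (localGradient f x₀ x₁) (-γ) d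
    (by rw [hx₁]; module)
  rw [← hV] at hp ⊢
  have hvec := norm_sub_smul_le hμ0
    (hμ1.le.trans ((one_le_inv₀ hμ0).mpr hμ1.le)) hγ0 hε0 hε1 hstep hd hps
  have hmain := real_inner_le_norm V (g - γ • T p)
  rw [inner_sub_right, inner_smul_right] at hmain
  rw [inner_sub_right, real_inner_self_eq_norm_sq] at hp
  have hVV : ‖V‖ * ‖V‖ ≤ ‖V‖ * ‖g - γ • T p‖ := by linear_combination hp + hmain
  refine le_trans ?_ hvec
  rcases (norm_nonneg V).eq_or_lt with h0 | h0
  · rw [← h0]; positivity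
  · exact le_of_mul_le_mul_left hVV h0
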